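/- For $s\in(1,3)$ let $f_s(x,t)=(x^4+t^2)^{-s/4}$ on $\mathbb{R}^2$, with $f_s(0,0)=+\infty$, and regard $f_s$ as the tempered distribution $\phi\mapsto\int_{\mathbb{R}^2}\phi f_s$. Then the (distributional) Fourier transform of $f_s$ is given by a non-negative locally integrable function $\widehat{f_s}$ on $\mathbb{R}^2$, and for every finite compactly supported (non-negative) Borel measure $\mu$ on $\mathbb{R}^2$ the function $\mathcal{F}^{-1}(\iota_{\#}\mu*\mu)$ is real-valued and non-negative, and $$\int f_s \, d(\iota_{\#}\mu*\mu)\;\le\;\int_{\mathbb{R}^2}\widehat{f_s}(\xi)\,\mathcal{F}^{-1}(\iota_{\#}\mu*\mu)(\xi)\,d\xi ,$$ where both sides are integrals of non-negative functions with values in $[0,\infty]$ (the right-hand side, and then possibly also the left-hand side, may be $+\infty$). Here $\iota(x)=-x$ for $x \in \mathbb{R}^2$, $\iota_{\#}\mu$ is the pushforward of $\mu$ under $\iota$, $*$ is Euclidean convolution of measures, the Fourier transform is normalised by $\widehat{\phi}(\xi)=\int e^{-2\pi i\langle x,\xi\rangle}\phi(x)\,dx$, and $\mathcal{F}^{-1}(\nu)(\xi)=\int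 e^{2\pi i\langle x,\xi\rangle}\,d\nu(x)$ for a finite Borel measure $\nu$. -/

import Mathlib

open MeasureTheory Set
open scoped ENNReal SchwartzMap FourierTransform

/-- The Euclidean plane `ℝ²`, with points `(x, t)`. -/
abbrev Plane : Type := EuclideanSpace ℝ (Fin 2)

/-- The Korányi kernel `f_s(x, t) = (x⁴ + t²)^(-s/4)` on `ℝ²`, with values in `[0, ∞]`.
For `s > 0` its value at the origin is `∞`, since `0 ^ y = ∞` for `y < 0` in `[0, ∞]`. -/
noncomputable def koranyiKernel (s : ℝ) (p : Plane) : ℝ≥0∞ :=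
  ENNReal.ofReal (p 0 ^ 4 + p 1 ^ 2) ^ (-(s / 4))

theorem koranyiKernel_zero {s : ℝ} (hs : 0 < s) : koranyiKernel s 0 = ∞ := by
  simp [koranyiKernel, hs]

theorem koranyiKernel_of_ne {s : ℝ} {p : Plane} (hp : p ≠ 0) :
    koranyiKernel s p = ENNReal.ofReal ((p 0 ^ 4 + p 1 ^ 2) ^ (-(s / 4))) := by
  refine ENNReal.ofReal_rpow_of_pos ?_
  by_contra h
  refine hp ?_
  have h0 : p 0 ^ 4 = 0 := by nlinarith [sq_nonneg (p 0 ^ 2), sq_nonneg (p 1)]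
  have h1 : p 1 ^ 2 = 0 := by nlinarith [sq_nonneg (p 0 ^ 2), sq_nonneg (p 1)]
  ext i
  fin_cases i
  · simpa using h0
  · simpa using h1

theorem measurable_koranyiKernel (s : ℝ) : Measurable (koranyiKernel s) := by
  unfold koranyiKernel
  fun_prop

theorem lintegral_Icc_abs_rpow_lt_top {a : ℝ} (ha : a < 1) :
    ∫⁻ x in Icc (-1 : ℝ) 1, ENNReal.ofReal |x| ^ (-a) < ∞ := by
  have h1 : ∫⁻ x in Icc (0 : ℝ) 1, ENNReal.ofReal |x| ^ (-a) < ∞ := by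
    have hi := (intervalIntegral.intervalIntegrable_rpow' (r := -a) (a := 0) (b := 1)
      (by linarith))
    rw [intervalIntegrable_iff_integrableOn_Ioc_of_le zero_le_one] at hi
    have hf := hi.lintegral_lt_top
    rw [← restrict_Ioc_eq_restrict_Icc]
    refine lt_of_le_of_lt (le_of_eq ?_) hf
    refine setLIntegral_congr_fun measurableSet_Ioc fun x hx => ?_
    simp only [abs_of_pos hx.1, ENNReal.ofReal_rpow_of_pos hx.1]
  have h2 : ∫⁻ x in Icc (-1 : ℝ) 0, ENNReal.ofReal |x| ^ (-a) < ∞ := by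
    have := (Measure.measurePreserving_neg (volume : Measure ℝ)).setLIntegral_comp_preimage_emb
      (MeasurableEquiv.neg ℝ).measurableEmbedding
      (fun x => ENNReal.ofReal |x| ^ (-a)) (Icc (-1 : ℝ) 0)
    rw [← this]
    simpa using h1
  have hu : Icc (-1 : ℝ) 1 = Icc (-1) 0 ∪ Icc 0 1 :=
    (Icc_union_Icc_eq_Icc (by norm_num) (by norm_num)).symm
  rw [hu]
  exact lt_of_le_of_lt (lintegral_union_le _ _ _) (ENNReal.add_lt_top.2 ⟨h2, h1⟩)

theorem koranyiKernel_le {s : ℝ} (hs : 0 < s) (p : Plane) :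
    koranyiKernel s p ≤ 1 +
      (Icc (-1 : ℝ) 1).indicator (fun x => ENNReal.ofReal |x| ^ (-(s / 3))) (p 0) *
      (Icc (-1 : ℝ) 1).indicator (fun x => ENNReal.ofReal |x| ^ (-(s / 3))) (p 1) := by
  by_cases h : 1 ≤ p 0 ^ 4 + p 1 ^ 2
  · refine le_add_right ?_
    unfold koranyiKernel
    rw [ENNReal.rpow_neg, ENNReal.inv_le_one]
    refine ENNReal.one_le_rpow (by simpa using h) (by linarith)
  · push Not at h
    refine le_add_left ?_
    have h0 : p 0 ∈ Icc (-1 : ℝ) 1 := by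
      rw [mem_Icc, ← abs_le]
      by_contra hc
      push Not at hc
      have : 1 < p 0 ^ 4 := by
        rw [← Even.pow_abs (by decide : Even 4)]
        exact one_lt_pow₀ hc (by norm_num)
      nlinarith [sq_nonneg (p 1)]
    have h1 : p 1 ∈ Icc (-1 : ℝ) 1 := by
      rw [mem_Icc, ← abs_le]
      by_contra hc
      push Not at hc
      have : 1 < p 1 ^ 2 := by
        rw [← sq_abs]
        exact one_lt_pow₀ hc (by norm_num)
      nlinarith [sq_nonneg (p 0 ^ 2)]
    rw [indicator_of_mem h0, indicator_of_mem h1,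
      ← ENNReal.mul_rpow_of_ne_top (by simp) (by simp)]
    unfold koranyiKernel
    have e : ∀ u : ℝ≥0∞, u ^ (-(s / 3)) = (u ^ (4 / 3 : ℝ)) ^ (-(s / 4)) := by
      intro u
      rw [← ENNReal.rpow_mul]
      congr 1
      ring
    rw [e, ENNReal.rpow_neg, ENNReal.rpow_neg, ENNReal.inv_le_inv]
    refine ENNReal.rpow_le_rpow ?_ (by linarith)
    rw [← ENNReal.ofReal_mul (abs_nonneg _),
      ENNReal.ofReal_rpow_of_nonneg (by positivity) (by norm_num)]
    refine ENNReal.ofReal_le_ofReal ?_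
    have hg := Real.geom_mean_le_arith_mean2_weighted (w₁ := 1 / 3) (w₂ := 2 / 3)
      (p₁ := |p 0| ^ 4) (p₂ := |p 1| ^ 2) (by norm_num) (by norm_num) (by positivity)
      (by positivity) (by norm_num)
    rw [← Real.rpow_natCast, ← Real.rpow_natCast, ← Real.rpow_mul (abs_nonneg _),
      ← Real.rpow_mul (abs_nonneg _)] at hg
    rw [Real.mul_rpow (abs_nonneg _) (abs_nonneg _)]
    norm_num at hg
    have e4 : |p 0| ^ 4 = p 0 ^ 4 := Even.pow_abs (by decide) _
    have p4 : 0 ≤ p 0 ^ 4 := by positivity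
    have p2 : 0 ≤ p 1 ^ 2 := by positivity
    rw [e4] at hg
    linarith

theorem lintegral_koranyi_majorant_lt_top {s : ℝ} (h3 : s < 3) :
    ∫⁻ p : Plane,
      (Icc (-1 : ℝ) 1).indicator (fun x => ENNReal.ofReal |x| ^ (-(s / 3))) (p 0) *
      (Icc (-1 : ℝ) 1).indicator (fun x => ENNReal.ofReal |x| ^ (-(s / 3))) (p 1) < ∞ := by
  set h : ℝ → ℝ≥0∞ :=
    (Icc (-1 : ℝ) 1).indicator (fun x => ENNReal.ofReal |x| ^ (-(s / 3))) with hh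
  have hm : Measurable h := Measurable.indicator (by fun_prop) measurableSet_Icc
  have hp : MeasurePreserving
      (fun p : Plane => MeasurableEquiv.finTwoArrow (α := ℝ) (WithLp.ofLp p)) :=
    (volume_preserving_finTwoArrow ℝ).comp (PiLp.volume_preserving_ofLp (Fin 2))
  have := hp.lintegral_comp (f := fun q : ℝ × ℝ => h q.1 * h q.2) (by fun_prop)
  have e : ∫⁻ p : Plane, h (p 0) * h (p 1) = ∫⁻ q : ℝ × ℝ, h q.1 * h q.2 := this
  rw [e, Measure.volume_eq_prod, lintegral_prod_mul hm.aemeasurable hm.aemeasurable]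
  have hf : ∫⁻ x, h x < ∞ := by
    rw [hh, lintegral_indicator measurableSet_Icc]
    exact lintegral_Icc_abs_rpow_lt_top (by linarith)
  exact ENNReal.mul_lt_top hf hf

/-- For `0 < s < 3` the measure `f_s dx dt` has temperate growth. -/
theorem hasTemperateGrowth_koranyiKernel {s : ℝ} (h0 : 0 < s) (h3 : s < 3) :
    (volume.withDensity (koranyiKernel s)).HasTemperateGrowth := by
  obtain ⟨n, hn⟩ := (inferInstance : (volume : Measure Plane).HasTemperateGrowth).exists_integrable
  have hc : Continuous fun x : Plane => (1 + ‖x‖) ^ (-(n : ℝ)) :=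
    Continuous.rpow_const (by fun_prop) fun x => Or.inl (by positivity)
  refine ⟨n, hc.aestronglyMeasurable, ?_⟩
  rw [HasFiniteIntegral, lintegral_withDensity_eq_lintegral_mul _ (measurable_koranyiKernel s)
    (by fun_prop)]
  refine lt_of_le_of_lt (lintegral_mono (g := fun p : Plane => ‖(1 + ‖p‖) ^ (-(n : ℝ))‖ₑ +
      (Icc (-1 : ℝ) 1).indicator (fun x => ENNReal.ofReal |x| ^ (-(s / 3))) (p 0) *
      (Icc (-1 : ℝ) 1).indicator (fun x => ENNReal.ofReal |x| ^ (-(s / 3))) (p 1)) ?_) ?_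
  · intro p
    have hle : ‖(1 + ‖p‖) ^ (-(n : ℝ))‖ₑ ≤ 1 := by
      rw [Real.enorm_of_nonneg (by positivity), ENNReal.ofReal_le_one]
      exact Real.rpow_le_one_of_one_le_of_nonpos (by linarith [norm_nonneg p]) (by simp)
    simp only [Pi.mul_apply]
    refine (mul_le_mul_left (koranyiKernel_le h0 p) _).trans ?_
    rw [add_mul, one_mul]
    exact add_le_add le_rfl (mul_le_of_le_one_right zero_le hle)
  · rw [lintegral_add_left (by fun_prop)]
    exact ENNReal.add_lt_top.2 ⟨hn.hasFiniteIntegral, lintegral_koranyi_majorant_lt_top h3⟩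

/-- The tempered distribution `φ ↦ ∫ φ f_s` defined by the Korányi kernel, for `0 < s < 3`. -/
noncomputable def koranyiDistribution (s : ℝ) (h0 : 0 < s) (h3 : s < 3) : 𝓢'(Plane, ℂ) :=
  haveI := hasTemperateGrowth_koranyiKernel h0 h3
  (volume.withDensity (koranyiKernel s)).toTemperedDistribution

theorem koranyiDistribution_apply (s : ℝ) (h0 : 0 < s) (h3 : s < 3) (φ : 𝓢(Plane, ℂ)) :
    koranyiDistribution s h0 h3 φ = ∫ p, (koranyiKernel s p).toReal • φ p := by
  have := hasTemperateGrowth_koranyiKernel h0 h3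
  have hne : ∀ᵐ p : Plane, koranyiKernel s p < ∞ := by
    have : ∀ᵐ p : Plane, p ≠ 0 := by simp [ae_iff]
    filter_upwards [this] with p hp
    rw [koranyiKernel_of_ne hp]
    exact ENNReal.ofReal_lt_top
  exact integral_withDensity_eq_integral_toReal_smul (measurable_koranyiKernel s) hne _

/-- The tempered distribution `T` is (given by) the locally integrable function `g`:
`T φ = ∫ φ g`, with absolutely convergent integrals, for every Schwartz function `φ`. -/
def IsGivenByFunction (T : 𝓢'(Plane, ℂ)) (g : Plane → ℝ) : Prop :=
  LocallyIntegrable g ∧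
    ∀ φ : 𝓢(Plane, ℂ), Integrable (fun ξ => φ ξ * (g ξ : ℂ)) ∧ T φ = ∫ ξ, φ ξ * (g ξ : ℂ)

/-- The Euclidean inverse Fourier transform `ξ ↦ ∫ e^{2πi⟨x, ξ⟩} dν(x)` of a finite measure. -/
noncomputable def invFourierMeasure (ν : Measure Plane) (ξ : Plane) : ℂ :=
  ∫ x, Complex.exp (2 * Real.pi * Complex.I * (inner ℝ x ξ : ℝ)) ∂ν

/-- The measure `ι_# μ * μ`, where `ι(x) = -x`. -/
noncomputable def reflConv (μ : Measure Plane) : Measure Plane :=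
  Measure.conv (μ.map fun x => -x) μ

/-! Put `α = s / 4` and `z = x² + it`. The kernel is `|z|^(-2α) = z^(-α) · conj(z)^(-α)`, and each
factor is a Laplace transform of a positive gamma density. Multiplying the two, with variables `u`
and `v`, writes `f_s` as a positive superposition of `e^(-2π(u+v)x²) e^(2πi(v-u)t)`. The Gaussian in
`x` is itself a positive superposition of characters `e^(2πixξ)`. So `f_s` is formally the inverse
Fourier transform of a positive density at the frequencies `(ξ, v - u)`, namely `spectralDensity α
0`.

To make this rigorous, `x²` is replaced by `ε + x²`. For `ε > 0` the density has finite mass, so the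
formula (`integral_cexp_spectralDensity`) and Fubini (`integral_regularizedKernel_mul`) are
unproblematic. Kernel and density both increase as `ε` decreases to `0`. Monotone convergence then
gives the energy identity, with equality in `[0, ∞]`, because `ι_# μ * μ` has transform `|F⁻¹μ|² ≥
0`. Dominated convergence identifies the distributional Fourier transform.

The dominating functions must have temperate growth. For the density this follows from a bound by a
multiple of `|τ|^(2α - 3/2)`: its proof needs `α < 3/4`, and local integrability in `τ` needs `α >
1/4`, that is, `1 < s < 3`. -/

/-! ### Gamma and Gaussian densities and their transforms. -/

/-- The density `(2π)^α / Γ(α) * u^(α-1) * e^(-2πεu)` on `(0, ∞)`; for `ε > 0` its Laplace transform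
at `2πz` is `(ε + z)^(-α)`. -/
noncomputable def gammaDensity (α ε u : ℝ) : ℝ :=
  (Ioi (0 : ℝ)).indicator (fun u => (2 * Real.pi) ^ α / Real.Gamma α * (u ^ (α - 1) *
    Real.exp (-(2 * Real.pi * ε * u)))) u

/-- The Fourier transform of `x ↦ e^(-2πwx²)`. -/
noncomputable def gaussianDensity (w ξ : ℝ) : ℝ :=
  (√(2 * w))⁻¹ * Real.exp (-Real.pi * ξ ^ 2 / (2 * w))

theorem gammaDensity_nonneg {α : ℝ} (hα : 0 < α) (ε u : ℝ) : 0 ≤ gammaDensity α ε u := by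
  refine indicator_nonneg (fun u hu => ?_) u
  have := Real.Gamma_pos_of_pos hα
  have h : 0 < u := hu
  positivity

theorem gammaDensity_of_pos {α ε u : ℝ} (hu : 0 < u) : gammaDensity α ε u =
    (2 * Real.pi) ^ α / Real.Gamma α * (u ^ (α - 1) * Real.exp (-(2 * Real.pi * ε * u))) :=
  indicator_of_mem (mem_Ioi.2 hu) _

theorem gammaDensity_of_nonpos {α ε u : ℝ} (hu : u ≤ 0) : gammaDensity α ε u = 0 :=
  indicator_of_notMem (by simpa using hu) _

@[fun_prop]
theorem measurable_gammaDensity (α ε : ℝ) : Measurable (gammaDensity α ε) :=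
  Measurable.indicator (by fun_prop) measurableSet_Ioi

theorem gammaDensity_antitone {α : ℝ} (hα : 0 < α) (u : ℝ) :
    Antitone fun ε => gammaDensity α ε u := by
  intro ε ε' h
  rcases le_or_gt u 0 with hu | hu
  · simp [gammaDensity_of_nonpos hu]
  · simp only [gammaDensity_of_pos hu]
    have := Real.Gamma_pos_of_pos hα
    gcongr

theorem continuous_gammaDensity_left (α u : ℝ) : Continuous fun ε => gammaDensity α ε u := by
  rcases le_or_gt u 0 with hu | hu
  · simp only [gammaDensity_of_nonpos hu]; fun_prop
  · simp only [gammaDensity_of_pos hu]; fun_prop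

theorem gaussianDensity_nonneg (w ξ : ℝ) : 0 ≤ gaussianDensity w ξ := by
  unfold gaussianDensity; positivity

@[fun_prop]
theorem Measurable.gaussianDensity {X : Type*} [MeasurableSpace X] {w ξ : X → ℝ}
    (hw : Measurable w) (hξ : Measurable ξ) :
    Measurable fun x => _root_.gaussianDensity (w x) (ξ x) := by
  unfold _root_.gaussianDensity; fun_prop

theorem gaussianDensity_le {w : ℝ} (hw : 0 < w) (ξ : ℝ) : gaussianDensity w ξ ≤ (√(2 * w))⁻¹ := by
  unfold gaussianDensity
  refine mul_le_of_le_one_right (by positivity) (Real.exp_le_one_iff.2 ?_)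
  rw [neg_mul, neg_div, neg_nonpos]
  positivity

theorem integrable_gaussianDensity {w : ℝ} (hw : 0 < w) : Integrable (gaussianDensity w) := by
  have h := (integrable_exp_neg_mul_sq (b := Real.pi / (2 * w)) (by positivity)).const_mul
    (√(2 * w))⁻¹
  refine h.congr (Filter.Eventually.of_forall fun ξ => ?_)
  simp only [gaussianDensity]
  congr 2; ring

theorem integral_gaussianDensity {w : ℝ} (hw : 0 < w) : ∫ ξ, gaussianDensity w ξ = 1 := by
  have h := integral_gaussian (Real.pi / (2 * w))
  have e : ∀ ξ, gaussianDensity w ξ =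
      (√(2 * w))⁻¹ * Real.exp (-(Real.pi / (2 * w)) * ξ ^ 2) := by
    intro ξ
    simp only [gaussianDensity]
    congr 2; ring
  simp_rw [e]
  rw [integral_const_mul, h, div_div_eq_mul_div, mul_div_cancel_left₀ _ Real.pi_ne_zero]
  exact inv_mul_cancel₀ (by positivity)

theorem integral_gaussianDensity_mul_cexp {w : ℝ} (hw : 0 < w) (x : ℝ) :
    ∫ ξ, (gaussianDensity w ξ : ℂ) * Complex.exp (2 * Real.pi * Complex.I * (x * ξ : ℝ)) =
      Complex.exp (-(2 * Real.pi * w * x ^ 2 : ℝ)) := by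
  have h := fourierIntegral_gaussian (b := ((Real.pi / (2 * w) : ℝ) : ℂ))
    (by rw [Complex.ofReal_re]; positivity) (2 * Real.pi * x)
  have e : ∀ ξ : ℝ, (gaussianDensity w ξ : ℂ) * Complex.exp (2 * Real.pi * Complex.I * (x * ξ : ℝ))
      = ((√(2 * w))⁻¹ : ℝ) * (Complex.exp (Complex.I * (2 * Real.pi * x) * ξ) *
        Complex.exp (-((Real.pi / (2 * w) : ℝ) : ℂ) * ξ ^ 2)) := by
    intro ξ
    simp only [gaussianDensity]
    push_cast
    rw [mul_assoc, mul_comm (Complex.exp _) (Complex.exp _)]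
    congr 2
    · congr 1; ring
    · congr 1; ring
  simp_rw [e]
  rw [integral_const_mul, h]
  have e1 : ((Real.pi : ℂ) / ((Real.pi / (2 * w) : ℝ) : ℂ)) ^ (1 / 2 : ℂ) = (√(2 * w) : ℝ) := by
    rw [← Complex.ofReal_div, Real.sqrt_eq_rpow, Complex.ofReal_cpow (by positivity)]
    rw [div_div_eq_mul_div, mul_div_cancel_left₀ _ Real.pi_ne_zero]
    norm_num
  rw [e1, ← mul_assoc, ← Complex.ofReal_mul, inv_mul_cancel₀ (by positivity), Complex.ofReal_one,
    one_mul]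
  congr 1
  have hp : (Real.pi : ℂ) ≠ 0 := by exact_mod_cast Real.pi_ne_zero
  have hw' : (w : ℂ) ≠ 0 := by exact_mod_cast hw.ne'
  push_cast
  field_simp
  ring

theorem integrable_gammaDensity {α ε : ℝ} (hα : 0 < α) (hε : 0 < ε) :
    Integrable (gammaDensity α ε) := by
  have h := (integrableOn_rpow_mul_exp_neg_mul_rpow (p := 1) (s := α - 1) (b := 2 * Real.pi * ε)
    (by linarith) one_pos (by positivity)).const_mul ((2 * Real.pi) ^ α / Real.Gamma α)
  refine ((integrable_indicator_iff measurableSet_Ioi).2 h).congr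
    (Filter.Eventually.of_forall fun u => ?_)
  unfold gammaDensity
  congr 1
  ext u
  simp

theorem integral_gammaDensity {α ε : ℝ} (hα : 0 < α) (hε : 0 < ε) :
    ∫ u, gammaDensity α ε u = (ε⁻¹) ^ α := by
  have h := Real.integral_rpow_mul_exp_neg_mul_Ioi hα (r := 2 * Real.pi * ε) (by positivity)
  unfold gammaDensity
  have hp : (1 / (2 * Real.pi * ε)) ^ α = ((2 * Real.pi) ^ α)⁻¹ * (ε⁻¹) ^ α := by
    rw [one_div, mul_inv, Real.mul_rpow (by positivity) (by positivity),
      Real.inv_rpow (by positivity)]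
  rw [integral_indicator measurableSet_Ioi, integral_const_mul, h, hp]
  have hG := (Real.Gamma_pos_of_pos hα).ne'
  have : (2 * Real.pi) ^ α ≠ 0 := by positivity
  generalize (2 * Real.pi) ^ α = c at *
  field_simp

/-- Exponential tilting only shifts `ε`, so the Laplace transform at a real point is the total mass
of another gamma density. -/
theorem gammaDensity_mul_exp (α ε t u : ℝ) :
    gammaDensity α ε u * Real.exp (t * u) = gammaDensity α (ε - t / (2 * Real.pi)) u := by
  rcases le_or_gt u 0 with hu | hu
  · simp [gammaDensity_of_nonpos hu]
  · rw [gammaDensity_of_pos hu, gammaDensity_of_pos hu, mul_assoc, mul_assoc, ← Real.exp_add]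
    have := Real.pi_ne_zero
    congr 3
    field_simp
    ring

/-- Analytic continuation: both sides are holomorphic on the half-plane `Re w < 2πε`, the left one
as a `complexMGF`, and they agree on its real points by tilting. -/
theorem integral_gammaDensity_mul_cexp_of_re_lt {α ε : ℝ} (hα : 0 < α) {w : ℂ}
    (hw : w.re < 2 * Real.pi * ε) :
    ∫ u, (gammaDensity α ε u : ℂ) * Complex.exp (w * u) =
      ((ε - w / (2 * Real.pi : ℝ))⁻¹) ^ (α : ℂ) := by
  set μ : Measure ℝ := volume.withDensity fun u => ENNReal.ofReal (gammaDensity α ε u) with hμ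
  have hm : Measurable fun u => ENNReal.ofReal (gammaDensity α ε u) := by fun_prop
  have hlt : ∀ᵐ u : ℝ, ENNReal.ofReal (gammaDensity α ε u) < ∞ := by simp
  have hpi : (0 : ℝ) < 2 * Real.pi := by positivity
  have hpos : ∀ {t : ℝ}, t < 2 * Real.pi * ε → 0 < ε - t / (2 * Real.pi) := by
    intro t ht
    rw [sub_pos, div_lt_iff₀ hpi]
    linarith
  have hre : ∀ z : ℂ, (ε - z / (2 * Real.pi : ℝ) : ℂ).re = ε - z.re / (2 * Real.pi) := by
    intro z
    rw [Complex.sub_re, Complex.div_ofReal_re, Complex.ofReal_re]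
  have hf : ∀ z : ℂ, ProbabilityTheory.complexMGF id μ z =
      ∫ u, (gammaDensity α ε u : ℂ) * Complex.exp (z * u) := by
    intro z
    rw [ProbabilityTheory.complexMGF, hμ, integral_withDensity_eq_integral_toReal_smul hm hlt]
    refine integral_congr_ae (Filter.Eventually.of_forall fun u => ?_)
    simp [ENNReal.toReal_ofReal (gammaDensity_nonneg hα ε u)]
  have hsub : Iio (2 * Real.pi * ε) ⊆ ProbabilityTheory.integrableExpSet id μ := by
    intro t ht
    rw [ProbabilityTheory.integrableExpSet, mem_ofPred_eq, hμ,
      integrable_withDensity_iff_integrable_smul' hm hlt]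
    refine (integrable_gammaDensity hα (hpos ht)).congr (Filter.Eventually.of_forall fun u => ?_)
    simp [ENNReal.toReal_ofReal (gammaDensity_nonneg hα ε u), gammaDensity_mul_exp]
  have hS : IsOpen {z : ℂ | z.re < 2 * Real.pi * ε} := isOpen_lt (by fun_prop) (by fun_prop)
  have hfan : AnalyticOnNhd ℂ (ProbabilityTheory.complexMGF id μ)
      {z : ℂ | z.re < 2 * Real.pi * ε} := fun z hz =>
    ProbabilityTheory.analyticAt_complexMGF (interior_maximal hsub isOpen_Iio hz)
  have hgan : AnalyticOnNhd ℂ (fun z : ℂ => ((ε - z / (2 * Real.pi : ℝ))⁻¹) ^ (α : ℂ))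
      {z : ℂ | z.re < 2 * Real.pi * ε} := by
    refine DifferentiableOn.analyticOnNhd (fun z hz => ?_) hS
    have hz' : 0 < (ε - z / (2 * Real.pi : ℝ) : ℂ).re := by rw [hre]; exact hpos hz
    have h0 : (ε - z / (2 * Real.pi : ℝ) : ℂ) ≠ 0 := by
      intro h; rw [h] at hz'; simp at hz'
    -- Inversion preserves positive real part, so the base stays in the slit plane, where the
    -- principal power is holomorphic.
    refine DifferentiableAt.differentiableWithinAt (DifferentiableAt.cpow_const ?_ (Or.inl ?_))
    · exact DifferentiableAt.inv (by fun_prop) h0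
    · rw [Complex.inv_re]
      exact div_pos hz' (Complex.normSq_pos.2 h0)
  have hconn : IsPreconnected {z : ℂ | z.re < 2 * Real.pi * ε} :=
    (convex_halfSpace_re_lt _).isPreconnected
  have hreal : ∀ t : ℝ, t < 2 * Real.pi * ε → ProbabilityTheory.complexMGF id μ t =
      (((ε : ℂ) - (t : ℂ) / (2 * Real.pi : ℝ))⁻¹) ^ (α : ℂ) := by
    intro t ht
    rw [hf]
    have e : ∀ u : ℝ, (gammaDensity α ε u : ℂ) * Complex.exp (t * u) =
        (gammaDensity α (ε - t / (2 * Real.pi)) u : ℝ) := by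
      intro u; rw [← gammaDensity_mul_exp]; push_cast; rfl
    simp_rw [e]
    rw [integral_complex_ofReal, integral_gammaDensity hα (hpos ht),
      Complex.ofReal_cpow (inv_nonneg.2 (hpos ht).le)]
    push_cast
    rfl
  rw [← hf]
  -- Any real point of the half-plane would do: the identity theorem needs agreement only along a
  -- set accumulating there.
  set t₀ : ℝ := 2 * Real.pi * ε - 1
  have hfreq : ∃ᶠ z : ℂ in nhdsWithin (t₀ : ℂ) {(t₀ : ℂ)}ᶜ,
      ProbabilityTheory.complexMGF id μ z = ((ε - z / (2 * Real.pi : ℝ))⁻¹) ^ (α : ℂ) := by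
    have hmap : Filter.Tendsto (fun t : ℝ => (t : ℂ)) (nhdsWithin t₀ {t₀}ᶜ)
        (nhdsWithin (t₀ : ℂ) {(t₀ : ℂ)}ᶜ) :=
      tendsto_nhdsWithin_of_tendsto_nhds_of_eventually_within _
        (Complex.continuous_ofReal.continuousAt.tendsto.mono_left nhdsWithin_le_nhds)
        (eventually_nhdsWithin_of_forall fun t ht => by simpa using ht)
    refine hmap.frequently (Filter.Eventually.frequently ?_)
    refine eventually_nhdsWithin_of_eventually_nhds ?_
    filter_upwards [Iio_mem_nhds (show t₀ < 2 * Real.pi * ε by simp [t₀])] with t ht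
    exact hreal t ht
  exact hfan.eqOn_of_preconnected_of_frequently_eq hgan hconn
    (show (t₀ : ℂ) ∈ {z : ℂ | z.re < 2 * Real.pi * ε} by simp [t₀]) hfreq hw

theorem integral_gammaDensity_mul_cexp {α ε : ℝ} (hα : 0 < α) (hε : 0 < ε) {z : ℂ}
    (hz : 0 ≤ z.re) :
    ∫ u, (gammaDensity α ε u : ℂ) * Complex.exp (-(2 * Real.pi * z * u)) =
      ((ε + z)⁻¹) ^ (α : ℂ) := by
  have hpi : (0 : ℝ) < 2 * Real.pi := by positivity
  have h := integral_gammaDensity_mul_cexp_of_re_lt (ε := ε) hα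
    (w := -((2 * Real.pi : ℝ) * z)) (by
      rw [Complex.neg_re, Complex.re_ofReal_mul]
      nlinarith [mul_pos hpi hε, mul_nonneg hpi.le hz])
  rw [neg_div, sub_neg_eq_add, mul_div_cancel_left₀ _ (by exact_mod_cast hpi.ne')] at h
  rw [← h]
  refine integral_congr_ae (Filter.Eventually.of_forall fun u => ?_)
  push_cast
  simp only [neg_mul]

/-- The product of the Laplace transforms at two conjugate points. -/
theorem inv_cpow_mul_inv_cpow_conj {z : ℂ} (hz : 0 < z.re) (α : ℝ) :
    (z⁻¹) ^ (α : ℂ) * (((starRingEnd ℂ) z)⁻¹) ^ (α : ℂ) = ((Complex.normSq z) ^ (-α) : ℝ) := by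
  have h0 : z ≠ 0 := by rintro rfl; simp at hz
  have hi : 0 < (z⁻¹).re := by
    rw [Complex.inv_re]; exact div_pos hz (Complex.normSq_pos.2 h0)
  -- Off the branch cut the principal power commutes with conjugation.
  have harg : (z⁻¹).arg ≠ Real.pi := by
    intro h
    have := (Complex.arg_eq_pi_iff.1 h).1
    linarith
  rw [← map_inv₀, Complex.conj_cpow _ _ harg, Complex.conj_ofReal, Complex.mul_conj,
    Complex.normSq_eq_norm_sq, Complex.norm_cpow_real, norm_inv, Complex.normSq_eq_norm_sq,
    ← Real.rpow_natCast, ← Real.rpow_natCast, ← Real.rpow_mul (by positivity),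
    ← Real.rpow_mul (by positivity), Real.inv_rpow (by positivity), ← Real.rpow_neg (by positivity)]
  congr 2
  push_cast
  ring

/-! ### The spectral density of the regularised kernel. -/

theorem lintegral_plane {f : Plane → ℝ≥0∞} (hf : Measurable f) :
    ∫⁻ p, f p = ∫⁻ ξ : ℝ, ∫⁻ τ : ℝ, f !₂[ξ, τ] := by
  have hp : MeasurePreserving
      (fun p : Plane => MeasurableEquiv.finTwoArrow (α := ℝ) (WithLp.ofLp p)) :=
    (volume_preserving_finTwoArrow ℝ).comp (PiLp.volume_preserving_ofLp (Fin 2))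
  have hg : Measurable fun q : ℝ × ℝ => f !₂[q.1, q.2] := hf.comp (by fun_prop)
  have h := hp.lintegral_comp hg
  rw [Measure.volume_eq_prod, lintegral_prod _ hg.aemeasurable] at h
  rw [← h]
  refine lintegral_congr fun p => ?_
  congr 1
  ext i
  fin_cases i <;> rfl

/-- For `ε > 0`, the Fourier transform of `(x, t) ↦ ((ε + x²)² + t²)^(-α)`. -/
noncomputable def spectralDensity (α ε : ℝ) (p : Plane) : ℝ≥0∞ :=
  ∫⁻ u, ENNReal.ofReal
    (gammaDensity α ε u * gammaDensity α ε (u + p 1) * gaussianDensity (u + (u + p 1)) (p 0))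

@[fun_prop]
theorem measurable_spectralDensity (α ε : ℝ) : Measurable (spectralDensity α ε) := by
  unfold spectralDensity
  refine Measurable.lintegral_prod_right (f := fun p : Plane => fun u : ℝ => ENNReal.ofReal
    (gammaDensity α ε u * gammaDensity α ε (u + p 1) * gaussianDensity (u + (u + p 1)) (p 0))) ?_
  unfold Function.uncurry
  fun_prop

/-- The density on the space of parameters `((u, v), ξ)`. -/
noncomputable def parameterDensity (α ε : ℝ) (q : (ℝ × ℝ) × ℝ) : ℝ≥0∞ :=
  ENNReal.ofReal (gammaDensity α ε q.1.1 * gammaDensity α ε q.1.2 *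
    gaussianDensity (q.1.1 + q.1.2) q.2)

@[fun_prop]
theorem measurable_parameterDensity (α ε : ℝ) : Measurable (parameterDensity α ε) := by
  unfold parameterDensity
  fun_prop

/-- The frequency `(ξ, v - u)` belonging to the parameter `((u, v), ξ)`. -/
noncomputable def frequency (q : (ℝ × ℝ) × ℝ) : Plane := !₂[q.2, q.1.2 - q.1.1]

@[fun_prop]
theorem measurable_frequency : Measurable frequency := by
  unfold frequency; fun_prop

/-- For fixed `ξ` the shear `(u, v) ↦ (u, v - u)` preserves Lebesgue measure, and integrating out
`u` leaves `spectralDensity`. Integrals against the latter can thus be computed in the variables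
`u`, `v`, where they factor. -/
theorem map_frequency_parameterDensity (α ε : ℝ) :
    (volume.withDensity (parameterDensity α ε)).map frequency =
      volume.withDensity (spectralDensity α ε) := by
  refine Measure.ext_of_lintegral _ fun f hf => ?_
  have hF := measurable_parameterDensity α ε
  have h1 : Measurable fun q : (ℝ × ℝ) × ℝ => parameterDensity α ε q * f (frequency q) := by
    fun_prop
  rw [lintegral_map hf measurable_frequency,
    lintegral_withDensity_eq_lintegral_mul _ (by fun_prop) (by fun_prop),
    lintegral_withDensity_eq_lintegral_mul _ (by fun_prop) hf,
    lintegral_plane (by fun_prop)]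
  simp only [Pi.mul_apply]
  rw [Measure.volume_eq_prod, lintegral_prod_symm _ (by fun_prop)]
  refine lintegral_congr fun ξ => ?_
  have h2 : Measurable fun q : ℝ × ℝ => parameterDensity α ε ((q.1, q.2), ξ) *
      f (frequency ((q.1, q.2), ξ)) := by fun_prop
  rw [Measure.volume_eq_prod, lintegral_prod _ h2.aemeasurable]
  have e : ∀ u : ℝ, ∫⁻ v, parameterDensity α ε ((u, v), ξ) * f (frequency ((u, v), ξ)) =
      ∫⁻ τ, parameterDensity α ε ((u, u + τ), ξ) * f !₂[ξ, τ] := by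
    intro u
    rw [← lintegral_add_left_eq_self _ u]
    simp [frequency]
  have h3 : Measurable fun q : ℝ × ℝ => parameterDensity α ε ((q.1, q.1 + q.2), ξ) *
      f !₂[ξ, q.2] := by fun_prop
  simp_rw [e]
  rw [lintegral_lintegral_swap h3.aemeasurable]
  refine lintegral_congr fun τ => ?_
  rw [lintegral_mul_const]
  · simp [spectralDensity, parameterDensity]
  · fun_prop

/-- The Gaussian in `ξ` has mass one, which leaves the product of two finite gamma masses. -/
theorem lintegral_parameterDensity_lt_top {α ε : ℝ} (hα : 0 < α) (hε : 0 < ε) :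
    ∫⁻ q, parameterDensity α ε q < ∞ := by
  rw [Measure.volume_eq_prod, lintegral_prod _ (by fun_prop)]
  have e : ∀ r : ℝ × ℝ, ∫⁻ ξ, parameterDensity α ε (r, ξ) =
      ENNReal.ofReal (gammaDensity α ε r.1) * ENNReal.ofReal (gammaDensity α ε r.2) := by
    intro r
    have h1 := gammaDensity_nonneg hα ε r.1
    have h2 := gammaDensity_nonneg hα ε r.2
    simp only [parameterDensity]
    simp_rw [ENNReal.ofReal_mul (mul_nonneg h1 h2), ENNReal.ofReal_mul h1]
    rw [lintegral_const_mul' _ _ (by finiteness)]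
    rcases le_or_gt r.1 0 with h | h
    · simp [gammaDensity_of_nonpos h]
    rcases le_or_gt r.2 0 with h' | h'
    · simp [gammaDensity_of_nonpos h']
    rw [← ofReal_integral_eq_lintegral_ofReal (integrable_gaussianDensity (add_pos h h'))
      (Filter.Eventually.of_forall fun ξ => gaussianDensity_nonneg _ _),
      integral_gaussianDensity (add_pos h h')]
    simp
  simp_rw [e]
  rw [Measure.volume_eq_prod, lintegral_prod_mul (f := fun u => ENNReal.ofReal (gammaDensity α ε u))
    (g := fun u => ENNReal.ofReal (gammaDensity α ε u)) (by fun_prop) (by fun_prop)]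
  have := (integrable_gammaDensity hα hε).lintegral_lt_top
  exact ENNReal.mul_lt_top this this

theorem isFiniteMeasure_parameterDensity {α ε : ℝ} (hα : 0 < α) (hε : 0 < ε) :
    IsFiniteMeasure (volume.withDensity (parameterDensity α ε)) :=
  isFiniteMeasure_withDensity (lintegral_parameterDensity_lt_top hα hε).ne

theorem isFiniteMeasure_spectralDensity {α ε : ℝ} (hα : 0 < α) (hε : 0 < ε) :
    IsFiniteMeasure (volume.withDensity (spectralDensity α ε)) := by
  have := isFiniteMeasure_parameterDensity hα hε
  rw [← map_frequency_parameterDensity]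
  infer_instance

/-- Integrating `ξ` out first turns the Gaussian into `e^(-2π(u+v)x₀²)`. Together with the character
`e^(2πi(v-u)x₁)` this splits into Laplace kernels at the conjugate points `x₀² ± ix₁`, one in `u`
and one in `v`. -/
theorem integral_cexp_spectralDensity {α ε : ℝ} (hα : 0 < α) (hε : 0 < ε) (x : Plane) :
    ∫ ξ, Complex.exp (2 * Real.pi * Complex.I * (inner ℝ x ξ : ℝ))
        ∂(volume.withDensity (spectralDensity α ε)) =
      (((ε + x 0 ^ 2) ^ 2 + x 1 ^ 2) ^ (-α) : ℝ) := by
  have hfin := isFiniteMeasure_parameterDensity hα hε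
  have hmeas : Measurable (parameterDensity α ε) := by fun_prop
  have hlt : ∀ᵐ q, parameterDensity α ε q < ∞ := by simp [parameterDensity]
  have hint : Integrable (fun q => Complex.exp (2 * Real.pi * Complex.I *
      (inner ℝ x (frequency q) : ℝ))) (volume.withDensity (parameterDensity α ε)) := by
    refine (integrable_const (1 : ℝ)).mono' (Measurable.aestronglyMeasurable (by fun_prop))
      (Filter.Eventually.of_forall fun q => le_of_eq ?_)
    rw [Complex.norm_exp]
    simp
  rw [← map_frequency_parameterDensity, integral_map (by fun_prop)
    (Measurable.aestronglyMeasurable (by fun_prop)),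
    integral_withDensity_eq_integral_toReal_smul hmeas hlt]
  rw [integrable_withDensity_iff_integrable_smul' hmeas hlt] at hint
  rw [Measure.volume_eq_prod] at hint ⊢
  rw [integral_prod _ hint]
  set z : ℂ := ⟨x 0 ^ 2, x 1⟩ with hz
  set z' : ℂ := ⟨x 0 ^ 2, -x 1⟩ with hz'
  have e : ∀ r : ℝ × ℝ, ∫ ξ, (parameterDensity α ε (r, ξ)).toReal •
      Complex.exp (2 * Real.pi * Complex.I * (inner ℝ x (frequency (r, ξ)) : ℝ)) =
      ((gammaDensity α ε r.1 : ℂ) * Complex.exp (-(2 * Real.pi * z * r.1))) *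
      ((gammaDensity α ε r.2 : ℂ) * Complex.exp (-(2 * Real.pi * z' * r.2))) := by
    intro r
    rcases le_or_gt r.1 0 with h | h
    · simp [parameterDensity, gammaDensity_of_nonpos h]
    rcases le_or_gt r.2 0 with h' | h'
    · simp [parameterDensity, gammaDensity_of_nonpos h']
    have e1 : ∀ ξ : ℝ, (parameterDensity α ε (r, ξ)).toReal •
        Complex.exp (2 * Real.pi * Complex.I * (inner ℝ x (frequency (r, ξ)) : ℝ)) =
        ((gammaDensity α ε r.1 * gammaDensity α ε r.2 : ℝ) *
          Complex.exp (2 * Real.pi * Complex.I * (x 1 * (r.2 - r.1) : ℝ))) *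
        ((gaussianDensity (r.1 + r.2) ξ : ℂ) *
          Complex.exp (2 * Real.pi * Complex.I * (x 0 * ξ : ℝ))) := by
      intro ξ
      have e2 : inner ℝ x (frequency (r, ξ)) = x 1 * (r.2 - r.1) + x 0 * ξ := by
        simp [frequency, PiLp.inner_apply, Fin.sum_univ_two]
        ring
      rw [e2, parameterDensity, ENNReal.toReal_ofReal (mul_nonneg (mul_nonneg
        (gammaDensity_nonneg hα _ _) (gammaDensity_nonneg hα _ _)) (gaussianDensity_nonneg _ _)),
        Complex.ofReal_add, mul_add, Complex.exp_add, Complex.real_smul, Complex.ofReal_mul]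
      ring
    simp_rw [e1]
    rw [integral_const_mul, integral_gaussianDensity_mul_cexp (add_pos h h'), mul_assoc,
      ← Complex.exp_add, mul_mul_mul_comm, ← Complex.exp_add, ← Complex.ofReal_mul]
    congr 2
    have ez : z = x 0 ^ 2 + x 1 * Complex.I := by
      rw [hz]; apply Complex.ext <;> simp [← Complex.ofReal_pow]
    have ez' : z' = x 0 ^ 2 - x 1 * Complex.I := by
      rw [hz']; apply Complex.ext <;> simp [← Complex.ofReal_pow]
    rw [ez, ez']
    push_cast
    ring
  simp_rw [e]
  rw [Measure.volume_eq_prod, integral_prod_mul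
    (fun u : ℝ => (gammaDensity α ε u : ℂ) * Complex.exp (-(2 * Real.pi * z * u)))
    (fun u : ℝ => (gammaDensity α ε u : ℂ) * Complex.exp (-(2 * Real.pi * z' * u))),
    integral_gammaDensity_mul_cexp hα hε (sq_nonneg (x 0)),
    integral_gammaDensity_mul_cexp hα hε (sq_nonneg (x 0))]
  have hconj : (ε + z' : ℂ) = (starRingEnd ℂ) (ε + z) := by
    apply Complex.ext <;> simp [hz, hz']
  rw [hconj, inv_cpow_mul_inv_cpow_conj]
  · congr 2
    rw [Complex.normSq_apply]
    simp [hz]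
    ring
  · simp only [Complex.add_re, Complex.ofReal_re, hz]
    positivity

/-! ### The limit `ε → 0` and growth of the limiting density. -/

theorem spectralDensity_antitone {α : ℝ} (hα : 0 < α) (p : Plane) :
    Antitone fun ε => spectralDensity α ε p := by
  intro ε ε' h
  refine lintegral_mono fun u => ENNReal.ofReal_le_ofReal ?_
  refine mul_le_mul_of_nonneg_right ?_ (gaussianDensity_nonneg _ _)
  exact mul_le_mul (gammaDensity_antitone hα _ h) (gammaDensity_antitone hα _ h)
    (gammaDensity_nonneg hα _ _) (gammaDensity_nonneg hα _ _)

theorem tendsto_spectralDensity {α : ℝ} (hα : 0 < α) {ε : ℕ → ℝ} (hε : Antitone ε)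
    (h0 : Filter.Tendsto ε Filter.atTop (nhds 0)) (p : Plane) :
    Filter.Tendsto (fun n => spectralDensity α (ε n) p) Filter.atTop
      (nhds (spectralDensity α 0 p)) := by
  refine lintegral_tendsto_of_tendsto_of_monotone (fun n => ?_) ?_ ?_
  · refine Measurable.aemeasurable ?_
    fun_prop
  · refine Filter.Eventually.of_forall fun u n m hnm => ENNReal.ofReal_le_ofReal ?_
    refine mul_le_mul_of_nonneg_right ?_ (gaussianDensity_nonneg _ _)
    exact mul_le_mul (gammaDensity_antitone hα _ (hε hnm)) (gammaDensity_antitone hα _ (hε hnm))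
      (gammaDensity_nonneg hα _ _) (gammaDensity_nonneg hα _ _)
  · refine Filter.Eventually.of_forall fun u => ?_
    have hc : Continuous fun ε : ℝ => ENNReal.ofReal (gammaDensity α ε u *
        gammaDensity α ε (u + p 1) * gaussianDensity (u + (u + p 1)) (p 0)) :=
      ENNReal.continuous_ofReal.comp (((continuous_gammaDensity_left α u).mul
        (continuous_gammaDensity_left α _)).mul continuous_const)
    exact (hc.tendsto 0).comp h0

/-- Split at `u = τ`. Below, `u + τ ≥ τ` and `u^(α-1)` is integrable at `0`; above, `u + τ ≥ u`
leaves the exponent `2α - 5/2`, which is less than `-1` because `α < 3/4`. -/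
theorem lintegral_rpow_mul_add_rpow_le {α τ : ℝ} (h0 : 0 < α) (h1 : α < 3 / 4) (hτ : 0 < τ) :
    ∫⁻ u in Ioi (0 : ℝ), ENNReal.ofReal (u ^ (α - 1) * (u + τ) ^ (α - 3 / 2)) ≤
      ENNReal.ofReal ((1 / α + 1 / (3 / 2 - 2 * α)) * τ ^ (2 * α - 3 / 2)) := by
  have hA : ∫⁻ u in Ioc (0 : ℝ) τ, ENNReal.ofReal (u ^ (α - 1) * (u + τ) ^ (α - 3 / 2)) ≤
      ENNReal.ofReal (1 / α * τ ^ (2 * α - 3 / 2)) := by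
    have hi := intervalIntegral.intervalIntegrable_rpow' (r := α - 1) (a := 0) (b := τ)
      (by linarith)
    rw [intervalIntegrable_iff_integrableOn_Ioc_of_le hτ.le] at hi
    have hi' := hi.mul_const (τ ^ (α - 3 / 2))
    calc _ ≤ ∫⁻ u in Ioc (0 : ℝ) τ, ENNReal.ofReal (u ^ (α - 1) * τ ^ (α - 3 / 2)) := by
          refine setLIntegral_mono' measurableSet_Ioc fun u hu => ENNReal.ofReal_le_ofReal ?_
          refine mul_le_mul_of_nonneg_left ?_ (Real.rpow_nonneg hu.1.le _)
          exact Real.rpow_le_rpow_of_nonpos hτ (by linarith [hu.1]) (by linarith)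
      _ = ENNReal.ofReal (∫ u in Ioc (0 : ℝ) τ, u ^ (α - 1) * τ ^ (α - 3 / 2)) := by
          rw [ofReal_integral_eq_lintegral_ofReal hi']
          filter_upwards [ae_restrict_mem measurableSet_Ioc] with u hu
          have := hu.1
          simp only [Pi.zero_apply]
          positivity
      _ = _ := by
          rw [integral_mul_const, ← intervalIntegral.integral_of_le hτ.le,
            integral_rpow (Or.inl (by linarith)), sub_add_cancel, Real.zero_rpow h0.ne', sub_zero,
            div_mul_eq_mul_div, ← Real.rpow_add hτ]
          congr 1
          ring_nf
  have hB : ∫⁻ u in Ioi τ, ENNReal.ofReal (u ^ (α - 1) * (u + τ) ^ (α - 3 / 2)) ≤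
      ENNReal.ofReal (1 / (3 / 2 - 2 * α) * τ ^ (2 * α - 3 / 2)) := by
    have hi := integrableOn_Ioi_rpow_of_lt (a := 2 * α - 5 / 2) (by linarith) hτ
    calc _ ≤ ∫⁻ u in Ioi τ, ENNReal.ofReal (u ^ (2 * α - 5 / 2)) := by
          refine setLIntegral_mono' measurableSet_Ioi fun u hu => ENNReal.ofReal_le_ofReal ?_
          have hu0 : 0 < u := hτ.trans hu
          rw [show 2 * α - 5 / 2 = (α - 1) + (α - 3 / 2) by ring, Real.rpow_add hu0]
          refine mul_le_mul_of_nonneg_left ?_ (Real.rpow_nonneg hu0.le _)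
          exact Real.rpow_le_rpow_of_nonpos hu0 (by linarith) (by linarith)
      _ = ENNReal.ofReal (∫ u in Ioi τ, u ^ (2 * α - 5 / 2)) := by
          rw [ofReal_integral_eq_lintegral_ofReal hi]
          filter_upwards [ae_restrict_mem measurableSet_Ioi] with u hu
          exact Real.rpow_nonneg (hτ.trans hu).le _
      _ = _ := by
          rw [integral_Ioi_rpow_of_lt (by linarith) hτ]
          congr 1
          rw [show 2 * α - 5 / 2 + 1 = 2 * α - 3 / 2 by ring, neg_div, ← div_neg, neg_sub]
          ring
  rw [← Ioc_union_Ioi_eq_Ioi hτ.le]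
  refine (lintegral_union_le _ _ _).trans ((add_le_add hA hB).trans (le_of_eq ?_))
  have : 0 < 3 / 2 - 2 * α := by linarith
  rw [← ENNReal.ofReal_add (by positivity) (by positivity), add_mul]

/-- Dropping the exponential in the Gaussian makes the bound uniform in `ξ`; its prefactor is at
most `(u + τ)^(-1/2)`, which lowers the exponent `α - 1` to `α - 3/2`. -/
theorem spectralDensity_zero_le_of_pos {α : ℝ} (h0 : 0 < α) (h1 : α < 3 / 4) (ξ : ℝ) {τ : ℝ}
    (hτ : 0 < τ) : spectralDensity α 0 !₂[ξ, τ] ≤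
      ENNReal.ofReal (((2 * Real.pi) ^ α / Real.Gamma α) ^ 2 *
        (1 / α + 1 / (3 / 2 - 2 * α))) * ENNReal.ofReal (τ ^ (2 * α - 3 / 2)) := by
  set c := (2 * Real.pi) ^ α / Real.Gamma α with hc
  have hc0 : 0 ≤ c := by
    have := Real.Gamma_pos_of_pos h0
    positivity
  have h2 : 0 < 3 / 2 - 2 * α := by linarith
  have hle : ∀ u, ENNReal.ofReal (gammaDensity α 0 u * gammaDensity α 0 (u + τ) *
      gaussianDensity (u + (u + τ)) ξ) ≤ (Ioi (0 : ℝ)).indicator (fun u => ENNReal.ofReal (c ^ 2) *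
        ENNReal.ofReal (u ^ (α - 1) * (u + τ) ^ (α - 3 / 2))) u := by
    intro u
    rcases le_or_gt u 0 with hu | hu
    · simp [gammaDensity_of_nonpos hu]
    have hv : 0 < u + τ := by linarith
    rw [indicator_of_mem (mem_Ioi.2 hu), ← ENNReal.ofReal_mul (by positivity)]
    refine ENNReal.ofReal_le_ofReal ?_
    have hg : gaussianDensity (u + (u + τ)) ξ ≤ (u + τ) ^ (-(1 / 2) : ℝ) := by
      refine (gaussianDensity_le (by linarith) ξ).trans ?_
      rw [Real.rpow_neg hv.le, ← Real.sqrt_eq_rpow]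
      exact inv_anti₀ (by positivity) (Real.sqrt_le_sqrt (by linarith))
    refine (mul_le_mul_of_nonneg_left hg (mul_nonneg (gammaDensity_nonneg h0 _ _)
      (gammaDensity_nonneg h0 _ _))).trans (le_of_eq ?_)
    rw [gammaDensity_of_pos hu, gammaDensity_of_pos hv,
      show α - 3 / 2 = (α - 1) + (-(1 / 2)) by ring, Real.rpow_add hv, ← hc]
    simp
    ring
  refine (lintegral_mono hle).trans ?_
  rw [lintegral_indicator measurableSet_Ioi, lintegral_const_mul' _ _ (by finiteness),
    ENNReal.ofReal_mul (by positivity), mul_assoc]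
  gcongr
  refine (lintegral_rpow_mul_add_rpow_le h0 h1 hτ).trans (le_of_eq ?_)
  rw [ENNReal.ofReal_mul (by positivity)]

/-- Exchanging the roles of `u` and `v` reverses the sign of `τ = v - u`. -/
theorem spectralDensity_neg (α ε ξ τ : ℝ) :
    spectralDensity α ε !₂[ξ, -τ] = spectralDensity α ε !₂[ξ, τ] := by
  unfold spectralDensity
  rw [← lintegral_add_right_eq_self _ τ]
  refine lintegral_congr fun u => ?_
  congr 1
  simp only [Matrix.cons_val_one, Matrix.cons_val_zero, Matrix.cons_val_fin_one]
  rw [show u + τ + -τ = u by ring, mul_comm (gammaDensity α ε (u + τ)),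
    show u + τ + u = u + (u + τ) by ring]

theorem exists_spectralDensity_zero_le {α : ℝ} (h0 : 0 < α) (h1 : α < 3 / 4) :
    ∃ C : ℝ, ∀ p : Plane, spectralDensity α 0 p ≤
      ENNReal.ofReal C * ENNReal.ofReal |p 1| ^ (-(3 / 2 - 2 * α)) := by
  have h2 : 0 < 3 / 2 - 2 * α := by linarith
  have hG := Real.Gamma_pos_of_pos h0
  refine ⟨((2 * Real.pi) ^ α / Real.Gamma α) ^ 2 * (1 / α + 1 / (3 / 2 - 2 * α)), fun p => ?_⟩
  have hp : p = !₂[p 0, p 1] := by ext i; fin_cases i <;> rfl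
  have hC : 0 < ((2 * Real.pi) ^ α / Real.Gamma α) ^ 2 * (1 / α + 1 / (3 / 2 - 2 * α)) := by
    positivity
  rcases lt_trichotomy (p 1) 0 with h | h | h
  · have := spectralDensity_zero_le_of_pos h0 h1 (p 0) (neg_pos.2 h)
    rw [spectralDensity_neg, ← hp] at this
    rw [abs_of_neg h, ENNReal.ofReal_rpow_of_pos (neg_pos.2 h), neg_sub]
    exact this
  -- On the line `τ = 0` the bound is `∞`, because the constant is strictly positive.
  · rw [h, abs_zero, ENNReal.ofReal_zero, ENNReal.zero_rpow_of_neg (by linarith),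
      ENNReal.mul_top (by simpa using hC)]
    exact le_top
  · have := spectralDensity_zero_le_of_pos h0 h1 (p 0) h
    rw [← hp] at this
    rw [abs_of_pos h, ENNReal.ofReal_rpow_of_pos h, neg_sub]
    exact this

theorem ae_spectralDensity_zero_lt_top {α : ℝ} (h0 : 0 < α) (h1 : α < 3 / 4) :
    ∀ᵐ p : Plane, spectralDensity α 0 p < ∞ := by
  obtain ⟨C, hC⟩ := exists_spectralDensity_zero_le h0 h1
  have hne : ∀ᵐ p : Plane, p 1 ≠ 0 := by
    have hm : MeasurableSet {p : Plane | p 1 = 0} := measurableSet_eq_fun (by fun_prop) (by fun_prop)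
    have hz : volume {p : Plane | p 1 = 0} = 0 := by
      rw [← lintegral_indicator_one hm,
        lintegral_plane (measurable_one.indicator hm)]
      refine (lintegral_congr fun ξ => ?_).trans lintegral_zero
      refine lintegral_eq_zero_of_ae_eq_zero ?_
      have h0 : ∀ᵐ τ : ℝ, τ ≠ 0 := by simp [ae_iff]
      filter_upwards [h0] with τ hτ
      exact indicator_of_notMem (by simpa using hτ) _
    simpa [ae_iff] using hz
  filter_upwards [hne] with p hp
  refine (hC p).trans_lt (ENNReal.mul_lt_top ENNReal.ofReal_lt_top ?_)
  rw [ENNReal.ofReal_rpow_of_pos (abs_pos.2 hp)]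
  exact ENNReal.ofReal_lt_top

/-- The singularity `|τ|^(-(3/2 - 2α))` is integrable across `τ = 0` exactly because `α > 1/4`. The
bound has no decay in `ξ`, so the weight has to supply it. -/
theorem hasTemperateGrowth_spectralDensity {α : ℝ} (h0 : 1 / 4 < α) (h1 : α < 3 / 4) :
    (volume.withDensity (spectralDensity α 0)).HasTemperateGrowth := by
  obtain ⟨C, hC⟩ := exists_spectralDensity_zero_le (by linarith) h1
  obtain ⟨n, hn⟩ := (inferInstance : (volume : Measure Plane).HasTemperateGrowth).exists_integrable
  obtain ⟨m, hm⟩ := (inferInstance : (volume : Measure ℝ).HasTemperateGrowth).exists_integrable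
  set h : ℝ → ℝ≥0∞ :=
    (Icc (-1 : ℝ) 1).indicator (fun x => ENNReal.ofReal |x| ^ (-(3 / 2 - 2 * α))) with hh
  have hmeas : Measurable h := Measurable.indicator (by fun_prop) measurableSet_Icc
  have hfin : ∫⁻ x, h x < ∞ := by
    rw [hh, lintegral_indicator measurableSet_Icc]
    exact lintegral_Icc_abs_rpow_lt_top (by linarith)
  have hle : ∀ x : ℝ, ENNReal.ofReal |x| ^ (-(3 / 2 - 2 * α)) ≤ 1 + h x := by
    intro x
    by_cases hx : x ∈ Icc (-1 : ℝ) 1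
    · rw [hh, indicator_of_mem hx]
      exact le_add_self
    · refine le_add_right ?_
      rw [ENNReal.rpow_neg, ENNReal.inv_le_one]
      refine ENNReal.one_le_rpow ?_ (by linarith)
      rw [mem_Icc, ← abs_le, not_le] at hx
      simpa using hx.le
  have hc : Continuous fun x : Plane => (1 + ‖x‖) ^ (-((n + m : ℕ) : ℝ)) :=
    Continuous.rpow_const (by fun_prop) fun x => Or.inl (by positivity)
  refine ⟨n + m, hc.aestronglyMeasurable, ?_⟩
  rw [HasFiniteIntegral, lintegral_withDensity_eq_lintegral_mul _ (by fun_prop) (by fun_prop)]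
  -- The exponent `n + m` serves two purposes: `n` makes the bounded part integrable on the plane,
  -- and `m` gives decay in `ξ` alone along the strip `|τ| ≤ 1`, where the singular part lives.
  refine lt_of_le_of_lt (lintegral_mono (g := fun p : Plane => ENNReal.ofReal C *
    (‖(1 + ‖p‖) ^ (-(n : ℝ))‖ₑ + ‖(1 + ‖p 0‖) ^ (-(m : ℝ))‖ₑ * h (p 1))) ?_) ?_
  · intro p
    have hp : 1 ≤ 1 + ‖p‖ := by linarith [norm_nonneg p]
    have en : ‖(1 + ‖p‖) ^ (-((n + m : ℕ) : ℝ))‖ₑ ≤ ‖(1 + ‖p‖) ^ (-(n : ℝ))‖ₑ := by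
      rw [Real.enorm_of_nonneg (by positivity), Real.enorm_of_nonneg (by positivity)]
      refine ENNReal.ofReal_le_ofReal (Real.rpow_le_rpow_of_exponent_le hp ?_)
      push_cast
      linarith [m.cast_nonneg (α := ℝ)]
    have em : ‖(1 + ‖p‖) ^ (-((n + m : ℕ) : ℝ))‖ₑ ≤ ‖(1 + ‖p 0‖) ^ (-(m : ℝ))‖ₑ := by
      rw [Real.enorm_of_nonneg (by positivity), Real.enorm_of_nonneg (by positivity)]
      refine ENNReal.ofReal_le_ofReal ((Real.rpow_le_rpow_of_exponent_le hp
        (y := -((n + m : ℕ) : ℝ)) (z := -(m : ℝ)) ?_).trans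
        (Real.rpow_le_rpow_of_nonpos (by positivity) ?_ (by simp)))
      · push_cast
        linarith [n.cast_nonneg (α := ℝ)]
      · gcongr
        exact PiLp.norm_apply_le p 0
    simp only [Pi.mul_apply]
    refine (mul_le_mul_left ((hC p).trans (mul_le_mul_right (hle (p 1)) _)) _).trans ?_
    rw [mul_assoc, add_mul, one_mul, mul_comm (h (p 1))]
    gcongr
  · rw [lintegral_const_mul' _ _ (by finiteness), lintegral_add_left (by fun_prop)]
    refine ENNReal.mul_lt_top ENNReal.ofReal_lt_top (ENNReal.add_lt_top.2
      ⟨hn.hasFiniteIntegral, ?_⟩)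
    rw [lintegral_plane (by fun_prop)]
    simp only [Matrix.cons_val_one, Matrix.cons_val_zero, Matrix.cons_val_fin_one]
    simp_rw [lintegral_const_mul _ hmeas]
    rw [lintegral_mul_const _ (by fun_prop)]
    exact ENNReal.mul_lt_top hm.hasFiniteIntegral hfin

/-! ### The regularised kernel and Fubini. -/

/-- The regularisation `((ε + x²)² + t²)^(-s/4)` of the Korányi kernel. -/
noncomputable def regularizedKernel (s ε : ℝ) (p : Plane) : ℝ≥0∞ :=
  ENNReal.ofReal ((ε + p 0 ^ 2) ^ 2 + p 1 ^ 2) ^ (-(s / 4))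

@[fun_prop]
theorem measurable_regularizedKernel (s ε : ℝ) : Measurable (regularizedKernel s ε) := by
  unfold regularizedKernel; fun_prop

theorem regularizedKernel_zero (s : ℝ) : regularizedKernel s 0 = koranyiKernel s := by
  ext p
  unfold regularizedKernel koranyiKernel
  congr 2
  ring

theorem regularizedKernel_antitone {s ε ε' : ℝ} (hs : 0 < s) (hε : 0 ≤ ε) (h : ε ≤ ε')
    (p : Plane) : regularizedKernel s ε' p ≤ regularizedKernel s ε p := by
  unfold regularizedKernel
  rw [ENNReal.rpow_neg, ENNReal.rpow_neg, ENNReal.inv_le_inv]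
  gcongr

theorem regularizedKernel_of_pos (s : ℝ) {ε : ℝ} (hε : 0 < ε) (p : Plane) :
    regularizedKernel s ε p =
      ENNReal.ofReal (((ε + p 0 ^ 2) ^ 2 + p 1 ^ 2) ^ (-(s / 4))) :=
  ENNReal.ofReal_rpow_of_pos (by positivity)

/-- Powers are continuous on `[0, ∞]`, so the origin, where the limit is `∞`, is included. -/
theorem tendsto_regularizedKernel (s : ℝ) {ε : ℕ → ℝ}
    (h0 : Filter.Tendsto ε Filter.atTop (nhds 0)) (p : Plane) :
    Filter.Tendsto (fun n => regularizedKernel s (ε n) p) Filter.atTop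
      (nhds (koranyiKernel s p)) := by
  rw [← regularizedKernel_zero]
  have hc : Continuous fun ε : ℝ => regularizedKernel s ε p :=
    ENNReal.continuous_rpow_const.comp (ENNReal.continuous_ofReal.comp (by fun_prop))
  exact (hc.tendsto 0).comp h0

theorem ae_spectralDensity_lt_top {α ε : ℝ} (hα : 0 < α) (hε : 0 < ε) :
    ∀ᵐ ξ, spectralDensity α ε ξ < ∞ := by
  have := isFiniteMeasure_spectralDensity hα hε
  refine ae_lt_top (by fun_prop) (ne_of_lt ?_)
  have := measure_lt_top (volume.withDensity (spectralDensity α ε)) univ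
  rwa [withDensity_apply _ MeasurableSet.univ, Measure.restrict_univ] at this

/-- Fubini's theorem for the regularised kernel and its Fourier transform. -/
theorem integral_regularizedKernel_mul {s ε : ℝ} (hs : 0 < s) (hε : 0 < ε) (ν : Measure Plane)
    [SFinite ν] {ψ : Plane → ℂ} (hψ : Integrable ψ ν) :
    ∫ x, (regularizedKernel s ε x).toReal • ψ x ∂ν =
      ∫ ξ, (spectralDensity (s / 4) ε ξ).toReal •
        ∫ x, Complex.exp (2 * Real.pi * Complex.I * (inner ℝ x ξ : ℝ)) * ψ x ∂ν := by
  have hα : 0 < s / 4 := by linarith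
  set ρ := volume.withDensity (spectralDensity (s / 4) ε) with hρ
  have hfin : IsFiniteMeasure ρ := isFiniteMeasure_spectralDensity hα hε
  have hlt := ae_spectralDensity_lt_top hα hε
  rw [← integral_withDensity_eq_integral_toReal_smul (by fun_prop) hlt, ← hρ,
    integral_integral_swap]
  · refine integral_congr_ae (Filter.Eventually.of_forall fun x => ?_)
    simp only
    rw [integral_mul_const, hρ, integral_cexp_spectralDensity hα hε,
      regularizedKernel_of_pos s hε, ENNReal.toReal_ofReal (by positivity), Complex.real_smul]
  -- Characters have modulus one and `ρ` is finite, so integrability of `ψ` gives absolute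
  -- convergence.
  · have h1 : Integrable (fun q : Plane × Plane => ψ q.2) (ρ.prod ν) := hψ.comp_snd ρ
    refine h1.mono (AEStronglyMeasurable.mul ?_ h1.aestronglyMeasurable) ?_
    · exact Continuous.aestronglyMeasurable (by fun_prop)
    · refine Filter.Eventually.of_forall fun q => le_of_eq ?_
      simp only [Function.uncurry]
      rw [norm_mul, Complex.norm_exp]
      simp

/-! ### Energies of measures. -/

/-- The transform turns convolution into a product and reflection into conjugation. -/
theorem invFourierMeasure_reflConv (μ : Measure Plane) [IsFiniteMeasure μ] (ξ : Plane) :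
    invFourierMeasure (reflConv μ) ξ = (Complex.normSq (invFourierMeasure μ ξ) : ℝ) := by
  have : IsFiniteMeasure (μ.map fun x => -x) := inferInstance
  have hint : ∀ ν : Measure Plane, IsFiniteMeasure ν → Integrable
      (fun x => Complex.exp (2 * Real.pi * Complex.I * (inner ℝ x ξ : ℝ))) ν := by
    intro ν hν
    refine (integrable_const (1 : ℝ)).mono' (Continuous.aestronglyMeasurable (by fun_prop))
      (Filter.Eventually.of_forall fun q => le_of_eq ?_)
    rw [Complex.norm_exp]
    simp
  rw [invFourierMeasure, reflConv, integral_conv (hint _ (by infer_instance))]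
  have e : ∀ x y : Plane, Complex.exp (2 * Real.pi * Complex.I * (inner ℝ (x + y) ξ : ℝ)) =
      Complex.exp (2 * Real.pi * Complex.I * (inner ℝ x ξ : ℝ)) *
      Complex.exp (2 * Real.pi * Complex.I * (inner ℝ y ξ : ℝ)) := by
    intro x y
    rw [inner_add_left, Complex.ofReal_add, mul_add, Complex.exp_add]
  simp_rw [e, integral_const_mul]
  rw [integral_mul_const, integral_map (by fun_prop)
    (Continuous.aestronglyMeasurable (by fun_prop)), Complex.normSq_eq_conj_mul_self]
  congr 1
  rw [invFourierMeasure, ← integral_conj]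
  refine integral_congr_ae (Filter.Eventually.of_forall fun x => ?_)
  simp only
  rw [← Complex.exp_conj]
  simp [show (starRingEnd ℂ) 2 = 2 from map_ofNat _ 2]

theorem re_invFourierMeasure_reflConv_nonneg (μ : Measure Plane) [IsFiniteMeasure μ] (ξ : Plane) :
    0 ≤ (invFourierMeasure (reflConv μ) ξ).re := by
  rw [invFourierMeasure_reflConv, Complex.ofReal_re]
  exact Complex.normSq_nonneg _

theorem continuous_invFourierMeasure (ν : Measure Plane) [IsFiniteMeasure ν] :
    Continuous (invFourierMeasure ν) := by
  refine continuous_of_dominated (bound := fun _ => (1 : ℝ)) (fun ξ => ?_) (fun ξ => ?_)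
    (integrable_const 1) ?_
  · exact Continuous.aestronglyMeasurable (by fun_prop)
  · refine Filter.Eventually.of_forall fun x => le_of_eq ?_
    rw [Complex.norm_exp]
    simp
  · exact Filter.Eventually.of_forall fun x => by fun_prop

/-- This is the Fubini identity with `ψ = 1`; both integrands are real, non-negative and integrable,
so it passes to `[0, ∞]`. -/
theorem lintegral_regularizedKernel {s ε : ℝ} (hs : 0 < s) (hε : 0 < ε) (μ : Measure Plane)
    [IsFiniteMeasure μ] :
    ∫⁻ x, regularizedKernel s ε x ∂(reflConv μ) =
      ∫⁻ ξ, spectralDensity (s / 4) ε ξ *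
        ENNReal.ofReal (invFourierMeasure (reflConv μ) ξ).re := by
  have hα : 0 < s / 4 := by linarith
  set ν := reflConv μ with hν
  have hfin : IsFiniteMeasure ν := by unfold ν reflConv; infer_instance
  have hρ := isFiniteMeasure_spectralDensity hα hε
  have hlt := ae_spectralDensity_lt_top hα hε
  have hkint : Integrable (fun x => ((ε + x 0 ^ 2) ^ 2 + x 1 ^ 2) ^ (-(s / 4))) ν := by
    -- The regularised kernel is largest at the origin, with value `(ε²)^(-s/4)`.
    refine (integrable_const ((ε ^ 2) ^ (-(s / 4)))).mono'
      (Measurable.aestronglyMeasurable (by fun_prop)) (Filter.Eventually.of_forall fun x => ?_)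
    rw [Real.norm_of_nonneg (by positivity)]
    refine Real.rpow_le_rpow_of_nonpos (by positivity) ?_ (by linarith)
    nlinarith [sq_nonneg (x 0), sq_nonneg (x 1), sq_nonneg (x 0 ^ 2)]
  have hre : Integrable (fun ξ => (spectralDensity (s / 4) ε ξ).toReal *
      (invFourierMeasure ν ξ).re) := by
    have hG := continuous_invFourierMeasure ν
    refine (integrable_withDensity_iff_integrable_smul' (by fun_prop) hlt).1 ?_
    refine (integrable_const (ν.real univ)).mono' (Continuous.aestronglyMeasurable (by fun_prop))
      (Filter.Eventually.of_forall fun ξ => (Complex.abs_re_le_norm _).trans ?_)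
    refine (norm_integral_le_integral_norm _).trans (le_of_eq ?_)
    simp [Complex.norm_exp]
  have h := integral_regularizedKernel_mul hs hε ν (integrable_const (1 : ℂ))
  have e1 : ∀ x, (regularizedKernel s ε x).toReal • (1 : ℂ) =
      ((((ε + x 0 ^ 2) ^ 2 + x 1 ^ 2) ^ (-(s / 4)) : ℝ) : ℂ) := by
    intro x
    rw [regularizedKernel_of_pos s hε, ENNReal.toReal_ofReal (by positivity), Complex.real_smul,
      mul_one]
  have e2 : ∀ ξ, (spectralDensity (s / 4) ε ξ).toReal •
      ∫ x, Complex.exp (2 * Real.pi * Complex.I * (inner ℝ x ξ : ℝ)) * 1 ∂ν =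
      (((spectralDensity (s / 4) ε ξ).toReal * (invFourierMeasure ν ξ).re : ℝ) : ℂ) := by
    intro ξ
    simp only [mul_one]
    change _ • invFourierMeasure ν ξ = _
    rw [hν, invFourierMeasure_reflConv, Complex.ofReal_re, Complex.real_smul, Complex.ofReal_mul]
  simp_rw [e1, e2] at h
  rw [integral_complex_ofReal, integral_complex_ofReal, Complex.ofReal_inj] at h
  simp_rw [regularizedKernel_of_pos s hε]
  rw [← ofReal_integral_eq_lintegral_ofReal hkint
    (Filter.Eventually.of_forall fun x => by simp only [Pi.zero_apply]; positivity), h,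
    ofReal_integral_eq_lintegral_ofReal hre (Filter.Eventually.of_forall fun ξ =>
      mul_nonneg ENNReal.toReal_nonneg (re_invFourierMeasure_reflConv_nonneg μ ξ))]
  refine lintegral_congr_ae ?_
  filter_upwards [hlt] with ξ hξ
  rw [ENNReal.ofReal_mul ENNReal.toReal_nonneg, ENNReal.ofReal_toReal hξ.ne]

/-- Both sides of the regularised identity increase as `ε` decreases to `0`; monotone convergence
keeps equality, infinite values included. -/
theorem lintegral_koranyiKernel_reflConv {s : ℝ} (hs : 0 < s) (μ : Measure Plane)
    [IsFiniteMeasure μ] :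
    ∫⁻ x, koranyiKernel s x ∂(reflConv μ) =
      ∫⁻ ξ, spectralDensity (s / 4) 0 ξ *
        ENNReal.ofReal (invFourierMeasure (reflConv μ) ξ).re := by
  have hν : IsFiniteMeasure (reflConv μ) := by unfold reflConv; infer_instance
  have hG := continuous_invFourierMeasure (reflConv μ)
  set ε : ℕ → ℝ := fun n => 1 / ((n : ℝ) + 1) with hε
  have hpos : ∀ n, 0 < ε n := fun n => by simp only [hε]; positivity
  have hanti : Antitone ε := fun n m h => one_div_le_one_div_of_le (by positivity) (by gcongr)
  have h0 : Filter.Tendsto ε Filter.atTop (nhds 0) := tendsto_one_div_add_atTop_nhds_zero_nat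
  have hL := lintegral_tendsto_of_tendsto_of_monotone (μ := reflConv μ)
    (fun n => (measurable_regularizedKernel s (ε n)).aemeasurable)
    (Filter.Eventually.of_forall fun x n m hnm =>
      regularizedKernel_antitone hs (hpos m).le (hanti hnm) x)
    (Filter.Eventually.of_forall fun x => tendsto_regularizedKernel s h0 x)
  have hR := lintegral_tendsto_of_tendsto_of_monotone (μ := (volume : Measure Plane))
    (f := fun n ξ => spectralDensity (s / 4) (ε n) ξ *
      ENNReal.ofReal (invFourierMeasure (reflConv μ) ξ).re)
    (F := fun ξ => spectralDensity (s / 4) 0 ξ *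
      ENNReal.ofReal (invFourierMeasure (reflConv μ) ξ).re)
    (fun n => Measurable.aemeasurable (by fun_prop))
    (Filter.Eventually.of_forall fun ξ n m hnm =>
      mul_le_mul_left (spectralDensity_antitone (by linarith) ξ (hanti hnm)) _)
    (Filter.Eventually.of_forall fun ξ => ENNReal.Tendsto.mul_const
      (tendsto_spectralDensity (by linarith) hanti h0 ξ) (Or.inr ENNReal.ofReal_ne_top))
  refine tendsto_nhds_unique hL (hR.congr fun n => ?_)
  exact (lintegral_regularizedKernel hs (hpos n) μ).symm

/-! ### The distributional Fourier transform and the conclusion. -/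

/-- Temperate growth makes `F` integrable after a polynomial weight; the inverse weight is
continuous and preserves local integrability. -/
theorem locallyIntegrable_toReal_of_hasTemperateGrowth {F : Plane → ℝ≥0∞} (hF : Measurable F)
    (hlt : ∀ᵐ p, F p < ∞) [h : (volume.withDensity F).HasTemperateGrowth] :
    LocallyIntegrable fun p => (F p).toReal := by
  obtain ⟨n, hn⟩ := h.exists_integrable
  rw [integrable_withDensity_iff_integrable_smul' hF hlt] at hn
  have hc : Continuous fun p : Plane => (1 + ‖p‖) ^ (n : ℝ) :=
    Continuous.rpow_const (by fun_prop) fun x => Or.inl (by positivity)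
  have h1 := hn.locallyIntegrable.locallyIntegrableOn univ
  have h2 := h1.continuousOn_smul isOpen_univ.isLocallyClosed hc.continuousOn
  rw [locallyIntegrableOn_univ] at h2
  refine h2.congr (Filter.Eventually.of_forall fun p => ?_)
  have : 0 < 1 + ‖p‖ := by positivity
  simp only [smul_eq_mul]
  rw [mul_left_comm, ← Real.rpow_add this, add_neg_cancel, Real.rpow_zero, mul_one]

/-- Fubini with `ψ = 𝓕 φ` and Fourier inversion give the formula for `ε > 0`. Both sides converge by
dominated convergence, the integrands at `ε = 0` being the majorants. -/
theorem fourier_koranyiDistribution_apply (s : ℝ) (h1 : 1 < s) (h3 : s < 3) (φ : 𝓢(Plane, ℂ)) :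
    (𝓕 (koranyiDistribution s (zero_lt_one.trans h1) h3)) φ =
      ∫ ξ, (spectralDensity (s / 4) 0 ξ).toReal • φ ξ := by
  have hs : 0 < s := by linarith
  have hα : 0 < s / 4 := by linarith
  have hgK := hasTemperateGrowth_koranyiKernel hs h3
  have hgF := hasTemperateGrowth_spectralDensity (α := s / 4) (by linarith) (by linarith)
  have hltF := ae_spectralDensity_zero_lt_top hα (by linarith)
  have hltK : ∀ᵐ p : Plane, koranyiKernel s p < ∞ := by
    have : ∀ᵐ p : Plane, p ≠ 0 := by simp [ae_iff]
    filter_upwards [this] with p hp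
    rw [koranyiKernel_of_ne hp]
    exact ENNReal.ofReal_lt_top
  have hiK : Integrable fun p => (koranyiKernel s p).toReal • (𝓕 φ) p :=
    (integrable_withDensity_iff_integrable_smul' (measurable_koranyiKernel s) hltK).1
      (𝓕 φ).integrable
  have hiF : Integrable fun ξ => (spectralDensity (s / 4) 0 ξ).toReal • φ ξ :=
    (integrable_withDensity_iff_integrable_smul' (by fun_prop) hltF).1 φ.integrable
  set ε : ℕ → ℝ := fun n => 1 / ((n : ℝ) + 1) with hε
  have hpos : ∀ n, 0 < ε n := fun n => by simp only [hε]; positivity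
  have hanti : Antitone ε := fun n m h => one_div_le_one_div_of_le (by positivity) (by gcongr)
  have h0 : Filter.Tendsto ε Filter.atTop (nhds 0) := tendsto_one_div_add_atTop_nhds_zero_nat
  have hinv : ∀ ξ, ∫ x, Complex.exp (2 * Real.pi * Complex.I * (inner ℝ x ξ : ℝ)) * (𝓕 φ) x =
      φ ξ := by
    intro ξ
    have h : (𝓕⁻ (𝓕 φ)) ξ = φ ξ := by rw [FourierPair.fourierInv_fourier_eq]
    rw [SchwartzMap.fourierInv_coe, Real.fourierInv_eq'] at h
    rw [← h]
    refine integral_congr_ae (Filter.Eventually.of_forall fun x => ?_)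
    simp only [smul_eq_mul]
    congr 2
    push_cast
    ring
  have hLim : Filter.Tendsto
      (fun n => ∫ x, (regularizedKernel s (ε n) x).toReal • (𝓕 φ) x) Filter.atTop
      (nhds (∫ x, (koranyiKernel s x).toReal • (𝓕 φ) x)) := by
    refine tendsto_integral_of_dominated_convergence _ (fun n => ?_) hiK.norm (fun n => ?_) ?_
    · exact AEStronglyMeasurable.smul
        (measurable_regularizedKernel s (ε n)).ennreal_toReal.aestronglyMeasurable
        (𝓕 φ).continuous.aestronglyMeasurable
    · filter_upwards [hltK] with x hx
      rw [norm_smul, norm_smul, Real.norm_of_nonneg ENNReal.toReal_nonneg,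
        Real.norm_of_nonneg ENNReal.toReal_nonneg]
      refine mul_le_mul_of_nonneg_right (ENNReal.toReal_mono hx.ne ?_) (norm_nonneg _)
      rw [← regularizedKernel_zero]
      exact regularizedKernel_antitone hs le_rfl (hpos n).le x
    · filter_upwards [hltK] with x hx
      exact (((ENNReal.tendsto_toReal hx.ne).comp (tendsto_regularizedKernel s h0 x))).smul_const _
  have hRim : Filter.Tendsto
      (fun n => ∫ ξ, (spectralDensity (s / 4) (ε n) ξ).toReal • φ ξ) Filter.atTop
      (nhds (∫ ξ, (spectralDensity (s / 4) 0 ξ).toReal • φ ξ)) := by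
    refine tendsto_integral_of_dominated_convergence _ (fun n => ?_) hiF.norm (fun n => ?_) ?_
    · exact AEStronglyMeasurable.smul
        (measurable_spectralDensity _ (ε n)).ennreal_toReal.aestronglyMeasurable
        φ.continuous.aestronglyMeasurable
    · filter_upwards [hltF] with x hx
      rw [norm_smul, norm_smul, Real.norm_of_nonneg ENNReal.toReal_nonneg,
        Real.norm_of_nonneg ENNReal.toReal_nonneg]
      exact mul_le_mul_of_nonneg_right (ENNReal.toReal_mono hx.ne
        (spectralDensity_antitone hα x (hpos n).le)) (norm_nonneg _)
    · filter_upwards [hltF] with x hx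
      exact (((ENNReal.tendsto_toReal hx.ne).comp
        (tendsto_spectralDensity hα hanti h0 x))).smul_const _
  rw [TemperedDistribution.fourier_apply, koranyiDistribution_apply]
  refine tendsto_nhds_unique hLim (hRim.congr fun n => ?_)
  rw [integral_regularizedKernel_mul hs (hpos n) volume (𝓕 φ).integrable]
  simp_rw [hinv]

theorem lemma3p3 (s : ℝ) (h1 : 1 < s) (h3 : s < 3) :
    ∃ fhat : Plane → ℝ,
      IsGivenByFunction (𝓕 (koranyiDistribution s (zero_lt_one.trans h1) h3)) fhat ∧
      (∀ ξ, 0 ≤ fhat ξ) ∧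
      ∀ (μ : Measure Plane) [IsFiniteMeasure μ], (∃ K : Set Plane, IsCompact K ∧ μ Kᶜ = 0) →
        (∀ ξ, (invFourierMeasure (reflConv μ) ξ).im = 0 ∧
          0 ≤ (invFourierMeasure (reflConv μ) ξ).re) ∧
        ∫⁻ p, koranyiKernel s p ∂(reflConv μ) ≤
          ∫⁻ ξ, ENNReal.ofReal (fhat ξ * (invFourierMeasure (reflConv μ) ξ).re) := by
  have hgF := hasTemperateGrowth_spectralDensity (α := s / 4) (by linarith) (by linarith)
  have hltF := ae_spectralDensity_zero_lt_top (α := s / 4) (by linarith) (by linarith)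
  have e : ∀ (φ : 𝓢(Plane, ℂ)) ξ, φ ξ * ((spectralDensity (s / 4) 0 ξ).toReal : ℂ) =
      (spectralDensity (s / 4) 0 ξ).toReal • φ ξ := by
    intro φ ξ
    rw [Complex.real_smul, mul_comm]
  refine ⟨fun ξ => (spectralDensity (s / 4) 0 ξ).toReal,
    ⟨locallyIntegrable_toReal_of_hasTemperateGrowth (by fun_prop) hltF, fun φ => ?_⟩,
    fun ξ => ENNReal.toReal_nonneg, fun μ _ _ => ⟨fun ξ => ⟨?_, ?_⟩, ?_⟩⟩
  · simp_rw [e]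
    exact ⟨(integrable_withDensity_iff_integrable_smul' (by fun_prop) hltF).1 φ.integrable,
      fourier_koranyiDistribution_apply s h1 h3 φ⟩
  · rw [invFourierMeasure_reflConv, Complex.ofReal_im]
  · exact re_invFourierMeasure_reflConv_nonneg μ ξ
  · rw [lintegral_koranyiKernel_reflConv (by linarith) μ]
    -- Equality holds; `toReal` loses nothing because the density is finite almost everywhere.
    refine le_of_eq (lintegral_congr_ae ?_)
    filter_upwards [hltF] with ξ hξ
    rw [ENNReal.ofReal_mul ENNReal.toReal_nonneg, ENNReal.ofReal_toReal hξ.ne]
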